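/- Let $A \in \mathbb{Z}^{m\times n}$, $b \in \mathbb{Z}^m$ and $c \in \mathbb{R}^n$, and let $\Delta$ denote the largest absolute value of the determinant of a (nonempty) square submatrix of $A$. For $I \subseteq [n] := \{1,\dots,n\}$ let ($I$-MIP) denote the mixed-integer linear program $$\max\{c^\intercal x : x \in \mathbb{R}^n,\ Ax \le b,\ x_i \in \mathbb{Z} \text{ for all } i \in I\},$$ so that ($\emptyset$-MIP) is a linear program and ($[n]$-MIP) is a pure integer program. Assume that $1 \le \Delta \le 2$ (that is, $A \neq 0$ and $\Delta \le 2$), and let $I, J \in \{\emptyset, [n]\}$ be such that ($J$-MIP) has an optimal solution. Then for every optimal solution $w$ of ($I$-MIP) there exists an optimal solution $z$ of ($J$-MIP) such that $\|w - z\|_\infty \le \Delta$. -/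

import Mathlib

open scoped Matrix

/-- `Δ(A)`: the largest absolute value of the determinant of a (nonempty) square submatrix of `A`.
The rows and columns of the submatrix are selected by injections; their order only affects the
sign of the determinant. -/
noncomputable def maxSubdet {m n : ℕ} (A : Matrix (Fin m) (Fin n) ℤ) : ℕ :=
  (Finset.Icc 1 (min m n)).sup fun k =>
    (Finset.univ : Finset (Fin k ↪ Fin m)).sup fun r =>
      (Finset.univ : Finset (Fin k ↪ Fin n)).sup fun s =>
        (A.submatrix r s).det.natAbs

/-- The feasible region of the mixed-integer program:
`{x ∈ ℝⁿ : A x ≤ b, x_i ∈ ℤ for all i ∈ I}`. -/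
def mipFeasible {m n : ℕ} (A : Matrix (Fin m) (Fin n) ℤ) (b : Fin m → ℤ) (I : Set (Fin n)) :
    Set (Fin n → ℝ) :=
  {x | (∀ i, (A.map (Int.cast : ℤ → ℝ) *ᵥ x) i ≤ (b i : ℝ)) ∧ ∀ j ∈ I, ∃ k : ℤ, x j = (k : ℝ)}

/-- `x` is an optimal solution of `max {cᵀ x : A x ≤ b, x_i ∈ ℤ for all i ∈ I}`. -/
def IsMIPOptimal {m n : ℕ} (A : Matrix (Fin m) (Fin n) ℤ) (b : Fin m → ℤ) (c : Fin n → ℝ)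
    (I : Set (Fin n)) (x : Fin n → ℝ) : Prop :=
  x ∈ mipFeasible A b I ∧ ∀ y ∈ mipFeasible A b I, c ⬝ᵥ y ≤ c ⬝ᵥ x

/-! Let M be A with the unit rows appended; since Δ ≥ 1, its subdeterminants are still at most Δ. An
LP optimum w is rounded to a vertex v of the box ⌊Mw⌋ ≤ Mx ≤ ⌈Mw⌉. This v is again optimal, lies
within 1 of w, and is half-integral by Cramer's rule (`IsMIPOptimal.exists_rounding`,
`RowsSpan.exists_half_integral`).

If v is not integral, let D/2 be the difference of v and an integer solution. The core lemma
`exists_odd_conformal` gives G ≡ D mod 2 with |MG| ≤ 2 and MG conformal to MD on the rows E where MD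
is even. Moving v by G/2 towards the integer solution yields an integer point. It is feasible: on
even rows it lies between two feasible values, and on odd rows v has slack at least 1/2 while AG =
±1.

To find G, take an extreme ray of the cone of vectors conformal to D on E. Since D is a nonzero
kernel vector mod 2 of the rows in E, every nonsingular choice of n of them has determinant ±2, and
its kernel mod 2 is {0, D}. So the ray has an integral generator X with |MX| ≤ 2 and X ≡ D or X ≡ 0
mod 2. In the first case G = X; in the second, D is replaced by D − X.

Put H = (D − G)/2. From LP to integer optima, optimality of v makes moving by −H harmless, and the
distance is at most 1 + 1. Conversely, v is chosen ℓ¹-nearest to w; exchanging along H forces H = 0,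
so v − w = G/2. -/

/-! ### Subdeterminants -/

theorem natAbs_det_submatrix_le_maxSubdet {m n k : ℕ} (A : Matrix (Fin m) (Fin n) ℤ) (hk : 1 ≤ k)
    (r : Fin k ↪ Fin m) (s : Fin k ↪ Fin n) :
    (A.submatrix r s).det.natAbs ≤ maxSubdet A := by
  have hm : k ≤ m := by simpa using Fintype.card_le_of_embedding r
  have hn : k ≤ n := by simpa using Fintype.card_le_of_embedding s
  refine le_trans ?_ (Finset.le_sup (Finset.mem_Icc.2 ⟨hk, le_min hm hn⟩))
  refine le_trans ?_ (Finset.le_sup (Finset.mem_univ r))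
  exact Finset.le_sup (f := fun s : Fin k ↪ Fin n => (A.submatrix r s).det.natAbs)
    (Finset.mem_univ s)

/-- The matrix `A` followed by the rows of the identity matrix. -/
abbrev withUnitRows {m n : ℕ} (A : Matrix (Fin m) (Fin n) ℤ) : Matrix (Fin m ⊕ Fin n) (Fin n) ℤ :=
  Matrix.fromRows A 1

/-- Appending the rows of the identity matrix does not create larger subdeterminants. -/
theorem natAbs_det_submatrix_withUnitRows_le {m n : ℕ} (A : Matrix (Fin m) (Fin n) ℤ)
    (hA : 1 ≤ maxSubdet A) (k : ℕ) (r : Fin k → Fin m ⊕ Fin n) (s : Fin k → Fin n) :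
    ((withUnitRows A).submatrix r s).det.natAbs ≤ maxSubdet A := by
  induction k with
  -- The empty determinant is 1, so Δ ≥ 1 is needed here.
  | zero => simpa using hA
  | succ k ih =>
    by_cases hs : Function.Injective s
    swap
    · obtain ⟨i, j, hij, hne⟩ : ∃ i j, s i = s j ∧ i ≠ j := by
        simpa [Function.Injective] using hs
      rw [Matrix.det_zero_of_column_eq hne (fun l => by simp [hij])]
      simp
    by_cases hr : Function.Injective r
    swap
    · obtain ⟨i, j, hij, hne⟩ : ∃ i j, r i = r j ∧ i ≠ j := by
        simpa [Function.Injective] using hr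
      rw [Matrix.det_zero_of_row_eq hne (by ext l; simp [hij])]
      simp
    by_cases h : ∃ i j, r i = Sum.inr j
    · obtain ⟨i, j, hij⟩ := h
      by_cases hj : ∃ l, s l = j
      · obtain ⟨l, hl⟩ := hj
        rw [Matrix.det_succ_row _ i, Finset.sum_eq_single l]
        · rw [Matrix.submatrix_submatrix]
          simp only [Matrix.submatrix_apply, hij, hl, Matrix.fromRows_apply_inr,
            Matrix.one_apply_eq, mul_one, Int.natAbs_mul, Int.natAbs_pow, Int.natAbs_neg,
            Int.natAbs_one, one_pow, one_mul]
          exact ih _ _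
        · intro l' _ hl'
          have : j ≠ s l' := fun e => hl' (hs (by rw [hl, e]))
          simp [hij, Matrix.one_apply_ne this]
        · simp
      · push Not at hj
        rw [Matrix.det_eq_zero_of_row_eq_zero i (fun l => by
          simp [hij, Matrix.one_apply_ne (hj l).symm])]
        simp
    · push Not at h
      have : ∀ i, ∃ a, r i = Sum.inl a := fun i => by
        rcases hi : r i with a | a
        · exact ⟨a, rfl⟩
        · exact (h i a hi).elim
      choose r' hr' using this
      have hinj : Function.Injective r' := fun a b hab => hr (by rw [hr', hr', hab])
      have := natAbs_det_submatrix_le_maxSubdet A (Nat.succ_pos k) ⟨r', hinj⟩ ⟨s, hs⟩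
      convert this using 3
      ext a b
      simp [hr']

/-! ### Spanning rows and vertices -/

/-- The rows of `M` indexed by `S` have no common nonzero real kernel vector. -/
def RowsSpan {ι : Type*} {n : ℕ} (M : Matrix ι (Fin n) ℝ) (S : Set ι) : Prop :=
  ∀ u : Fin n → ℝ, (∀ i ∈ S, (M *ᵥ u) i = 0) → u = 0

/-- A proper span would be annihilated by a nonzero functional, that is, by a nonzero kernel vector;
so the rows span and contain a basis. -/
theorem RowsSpan.exists_det_ne_zero {ι : Type*} {n : ℕ} {M : Matrix ι (Fin n) ℝ} {S : Set ι}
    (h : RowsSpan M S) : ∃ r : Fin n → ι, (∀ k, r k ∈ S) ∧ (M.submatrix r id).det ≠ 0 := by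
  have hspan : Submodule.span ℝ (M '' S) = ⊤ := by
    by_contra hne
    obtain ⟨f, hf, hle⟩ := Submodule.exists_le_ker_of_lt_top _ (lt_top_iff_ne_top.2 hne)
    have hrep : ∀ x : Fin n → ℝ, f x = x ⬝ᵥ fun j => f (Pi.single j 1) := by
      intro x
      conv_lhs => rw [pi_eq_sum_univ' x]
      simp [dotProduct, Pi.single]
    apply hf
    have h0 : (fun j => f (Pi.single j 1)) = 0 := h _ fun i hi => by
      have : f (M i) = 0 := hle (Submodule.subset_span ⟨i, hi, rfl⟩)
      rwa [hrep] at this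
    ext x
    simp [congrFun h0 x]
  obtain ⟨t, hts, htspan, hli⟩ := exists_linearIndependent ℝ (M '' S)
  rw [hspan] at htspan
  let bs : Module.Basis t ℝ (Fin n → ℝ) := Module.Basis.mk hli (by simp [htspan])
  have : Finite t := Module.Finite.finite_basis bs
  have : Fintype t := Fintype.ofFinite t
  have hcard : Fintype.card t = n := by
    rw [← Module.finrank_eq_card_basis bs]; simp
  let e : Fin n ≃ t := (Fintype.equivFinOfCardEq hcard).symm
  have : ∀ k, ∃ i ∈ S, M i = (e k : Fin n → ℝ) := fun k => hts (e k).2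
  choose r hrS hr using this
  refine ⟨r, hrS, ?_⟩
  have hli' : LinearIndependent ℝ (M.submatrix r id).row := by
    have hrow : (M.submatrix r id).row = (Subtype.val : t → Fin n → ℝ) ∘ e := by
      ext k j
      simp [← hr]
    rw [hrow]
    exact hli.comp e e.injective
  rw [Matrix.linearIndependent_rows_iff_isUnit, Matrix.isUnit_iff_isUnit_det] at hli'
  exact hli'.ne_zero

/-- A nonempty polytope `{x | l ≤ M x ≤ h}` has a vertex. -/
theorem exists_vertex {κ : Type*} [Fintype κ] {n : ℕ} (M : Matrix κ (Fin n) ℝ)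
    (hM : RowsSpan M Set.univ) (l h : κ → ℝ) (w : Fin n → ℝ)
    (hw : ∀ i, l i ≤ (M *ᵥ w) i ∧ (M *ᵥ w) i ≤ h i) :
    ∃ v : Fin n → ℝ, (∀ i, l i ≤ (M *ᵥ v) i ∧ (M *ᵥ v) i ≤ h i) ∧
      RowsSpan M {i | (M *ᵥ v) i = l i ∨ (M *ᵥ v) i = h i} := by
  let P : Set (Fin n → ℝ) := M.mulVecLin ⁻¹' Set.Icc l h
  have hmem : ∀ x, x ∈ P ↔ ∀ i, l i ≤ (M *ᵥ x) i ∧ (M *ᵥ x) i ≤ h i := fun x => by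
    simp [P, Pi.le_def, forall_and]
  have hker : LinearMap.ker M.mulVecLin = ⊥ := by
    rw [LinearMap.ker_eq_bot']
    intro u hu
    exact hM u fun i _ => congrFun hu i
  have hcomp : IsCompact P :=
    (LinearMap.isClosedEmbedding_of_injective hker).isCompact_preimage isCompact_Icc
  obtain ⟨v, hv⟩ := hcomp.extremePoints_nonempty ⟨w, (hmem w).2 hw⟩
  have hvP := (hmem v).1 hv.1
  refine ⟨v, hvP, fun u hu => ?_⟩
  -- If `u` is killed by the tight rows, v ± εu stays in the polytope for small ε, and extremality
  -- forces u = 0.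
  have hev : ∀ᶠ ε in nhds (0 : ℝ), ∀ i, l i ≤ (M *ᵥ (v + ε • u)) i ∧
      (M *ᵥ (v + ε • u)) i ≤ h i := by
    rw [Filter.eventually_all]
    intro i
    simp only [Matrix.mulVec_add, Matrix.mulVec_smul, Pi.add_apply, Pi.smul_apply, smul_eq_mul]
    by_cases hi : (M *ᵥ v) i = l i ∨ (M *ᵥ v) i = h i
    · filter_upwards with ε
      rw [hu i hi]
      simpa using hvP i
    · push Not at hi
      have ht : Filter.Tendsto (fun ε : ℝ => (M *ᵥ v) i + ε * (M *ᵥ u) i) (nhds 0)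
          (nhds ((M *ᵥ v) i)) := by
        have : Continuous fun ε : ℝ => (M *ᵥ v) i + ε * (M *ᵥ u) i := by fun_prop
        simpa using this.tendsto 0
      filter_upwards [ht.eventually_const_lt (lt_of_le_of_ne (hvP i).1 hi.1.symm),
        ht.eventually_lt_const (lt_of_le_of_ne (hvP i).2 hi.2)] with ε h1 h2
      exact ⟨h1.le, h2.le⟩
  have hev' : ∀ᶠ ε in nhds (0 : ℝ), ∀ i, l i ≤ (M *ᵥ (v + (-ε) • u)) i ∧
      (M *ᵥ (v + (-ε) • u)) i ≤ h i := by
    have : Filter.Tendsto (fun ε : ℝ => -ε) (nhds 0) (nhds 0) := by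
      simpa using (continuous_neg (G := ℝ)).tendsto 0
    exact this.eventually hev
  obtain ⟨ε, ⟨h1, h2⟩, hε⟩ := (((hev.and hev').filter_mono nhdsWithin_le_nhds).and
    (self_mem_nhdsWithin : Set.Ioi (0 : ℝ) ∈ nhdsWithin 0 (Set.Ioi 0))).exists
  have hseg : v ∈ openSegment ℝ (v + ε • u) (v + (-ε) • u) :=
    ⟨1 / 2, 1 / 2, by norm_num, by norm_num, by norm_num, by ext j; simp; ring⟩
  have := hv.2 ((hmem _).2 h1) ((hmem _).2 h2) hseg
  have hz : ε • u = 0 := by simpa using this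
  exact (smul_eq_zero.1 hz).resolve_left (ne_of_gt hε)

/-! ### Kernels modulo 2 -/

theorem dvd_mulVec {ι : Type*} {n : ℕ} {d : ℤ} (M : Matrix ι (Fin n) ℤ) (Y : Fin n → ℤ)
    (hY : ∀ j, d ∣ Y j) (i : ι) : d ∣ (M *ᵥ Y) i := by
  simp only [Matrix.mulVec, dotProduct]
  exact Finset.dvd_sum fun j _ => Dvd.dvd.mul_left (hY j) _

/-- A nonzero kernel vector mod 2 makes N singular over the field with two elements. -/
theorem two_dvd_det_of_mulVec {n : ℕ} (N : Matrix (Fin n) (Fin n) ℤ) (Y : Fin n → ℤ)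
    (hY : ∃ j, ¬ 2 ∣ Y j) (hN : ∀ i, 2 ∣ (N *ᵥ Y) i) : 2 ∣ N.det := by
  obtain ⟨j, hj⟩ := hY
  have h : (N.adjugate *ᵥ (N *ᵥ Y)) j = N.det * Y j := by
    rw [Matrix.mulVec_mulVec, Matrix.adjugate_mul]
    simp
  have h2 : (2 : ℤ) ∣ N.det * Y j := by
    rw [← h]
    exact dvd_mulVec _ _ hN j
  exact (Int.prime_two.dvd_or_dvd h2).resolve_right hj

/-- If `det N = ± 2`, then the kernel of `N` modulo `2` has at most one nonzero element. -/
theorem even_or_congr_of_mulVec_even {n : ℕ} (N : Matrix (Fin n) (Fin n) ℤ)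
    (hdet : N.det.natAbs = 2) (X D : Fin n → ℤ) (hD : ∃ j, ¬ 2 ∣ D j)
    (hNX : ∀ i, 2 ∣ (N *ᵥ X) i) (hND : ∀ i, 2 ∣ (N *ᵥ D) i) :
    (∀ j, 2 ∣ X j) ∨ (∀ j, 2 ∣ D j - X j) := by
  by_contra hcon
  push Not at hcon
  obtain ⟨hX, hDX⟩ := hcon
  -- Otherwise X and D are independent mod 2, so some nonzero combination has even i-th entry. It
  -- stays in the kernel mod 2 when a row is replaced by the i-th unit row, so each cofactor is
  -- even.
  have key : ∀ i j, (2 : ℤ) ∣ N.adjugate i j := by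
    intro i j
    obtain ⟨Y, hY, hNY, hYi⟩ : ∃ Y : Fin n → ℤ, (∃ j, ¬ 2 ∣ Y j) ∧ (∀ i, 2 ∣ (N *ᵥ Y) i) ∧
        2 ∣ Y i := by
      by_cases h1 : 2 ∣ X i
      · exact ⟨X, hX, hNX, h1⟩
      by_cases h2 : 2 ∣ D i
      · exact ⟨D, hD, hND, h2⟩
      refine ⟨D - X, hDX, fun k => ?_, ?_⟩
      · rw [Matrix.mulVec_sub]
        exact dvd_sub (hND k) (hNX k)
      · simp only [Pi.sub_apply]
        omega
    rw [Matrix.adjugate_apply]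
    refine two_dvd_det_of_mulVec _ Y hY fun k => ?_
    by_cases hk : k = j
    · subst hk
      simpa [Matrix.mulVec] using hYi
    · simpa [Matrix.mulVec, Matrix.updateRow_ne hk] using hNY k
  choose K hK using key
  have hadj : N.adjugate = (2 : ℤ) • Matrix.of K := by
    ext i j
    simp [hK]
  have h1 := Matrix.mul_adjugate N
  rw [hadj, Matrix.mul_smul] at h1
  -- Halving the adjugate gives an integral K with NK = ±1, which is impossible for det N = ±2.
  have h2 : N * Matrix.of K = (N.det / 2) • (1 : Matrix (Fin n) (Fin n) ℤ) := by
    ext i j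
    have h3 := congrFun (congrFun h1 i) j
    simp only [Matrix.smul_apply, smul_eq_mul] at h3 ⊢
    have h4 : N.det = 2 * (N.det / 2) := by omega
    rw [h4, mul_assoc] at h3
    exact mul_left_cancel₀ two_ne_zero h3
  have h5 := congrArg Matrix.det h2
  rw [Matrix.det_mul, Matrix.det_smul, Matrix.det_one, mul_one] at h5
  have h6 := congrArg Int.natAbs h5
  rw [Int.natAbs_mul, hdet, Int.natAbs_pow] at h6
  have h7 : (N.det / 2).natAbs = 1 := by omega
  rw [h7, one_pow] at h6
  omega

/-! ### Conformal vectors -/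

/-- `a` lies between `0` and `b`. -/
def IsConformal (a b : ℤ) : Prop :=
  (0 ≤ a ∧ a ≤ b) ∨ (b ≤ a ∧ a ≤ 0)

/-- Laplace expansion along the replaced row k. Thus a bound on subdeterminants bounds all of MX
when X is an adjugate column. -/
theorem mulVec_adjugate_col {ι : Type*} {n : ℕ} (M : Matrix ι (Fin n) ℤ) (r : Fin n → ι)
    (k : Fin n) (i : ι) :
    (M *ᵥ fun j => (M.submatrix r id).adjugate j k) i =
      (M.submatrix (Function.update r k i) id).det := by
  rw [Matrix.det_eq_sum_mul_adjugate_row _ k]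
  simp only [Matrix.mulVec, dotProduct]
  refine Finset.sum_congr rfl fun j _ => ?_
  rw [Matrix.adjugate_apply, Matrix.adjugate_apply]
  congr 2
  · simp
  · ext a b
    by_cases ha : a = k
    · subst ha; simp
    · simp [ha]

/-- An integral extreme ray of the cone of vectors conformal to `D`. -/
theorem exists_elementary_conformal {ι : Type*} [Fintype ι] {n : ℕ} (M : Matrix ι (Fin n) ℤ)
    (hM : ∀ r : Fin n → ι, (M.submatrix r id).det.natAbs ≤ 2) (D : Fin n → ℤ)
    (hD : ∃ j, ¬ 2 ∣ D j)
    (hE : RowsSpan (M.map (Int.cast : ℤ → ℝ)) {i | 2 ∣ (M *ᵥ D) i}) :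
    ∃ X : Fin n → ℤ, (∃ i, 2 ∣ (M *ᵥ D) i ∧ (M *ᵥ X) i ≠ 0) ∧
      (∀ i, |(M *ᵥ X) i| ≤ 2) ∧
      (∀ i, 2 ∣ (M *ᵥ D) i → IsConformal ((M *ᵥ X) i) ((M *ᵥ D) i)) ∧
      ((∀ j, 2 ∣ X j) ∨ (∀ j, 2 ∣ D j - X j)) := by
  classical
  set E : Set ι := {i | 2 ∣ (M *ᵥ D) i} with hEdef
  set MR : Matrix ι (Fin n) ℝ := M.map (Int.cast : ℤ → ℝ) with hMR
  have hcast : ∀ (Y : Fin n → ℤ) i, (MR *ᵥ fun j => (Y j : ℝ)) i = ((M *ᵥ Y) i : ℝ) := by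
    intro Y i
    simp [hMR, Matrix.mulVec, dotProduct]
  set e : ι → ℤ := M *ᵥ D with he
  -- The value 1 where `e i = 0` keeps such rows visible in `f`, so that they can be pinned to 0 and
  -- the rows of `f` still span.
  let τ : ι → ℝ := fun i => if e i = 0 then 1 else ((e i).sign : ℝ)
  let f : Matrix (Option E) (Fin n) ℝ := fun k => Option.casesOn k
    (fun j => ∑ i : E, ((e i).sign : ℝ) * MR i j) (fun i j => τ i * MR i j)
  have hfn : ∀ x, (f *ᵥ x) none = ∑ i : E, ((e i).sign : ℝ) * (MR *ᵥ x) i := by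
    intro x
    simp only [f, Matrix.mulVec, dotProduct, Finset.sum_mul, Finset.mul_sum]
    rw [Finset.sum_comm]
    simp only [mul_assoc]
  have hfs : ∀ x (i : E), (f *ᵥ x) (some i) = τ i * (MR *ᵥ x) i := by
    intro x i
    simp only [f, Matrix.mulVec, dotProduct, Finset.mul_sum, mul_assoc]
  have hτ : ∀ i, τ i ≠ 0 := by
    intro i
    by_cases h : e i = 0 <;> simp [τ, h]
  have hfspan : RowsSpan f Set.univ := by
    intro u hu
    refine hE u fun i hi => ?_
    have := hu (some ⟨i, hi⟩) (Set.mem_univ _)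
    rw [hfs] at this
    exact (mul_eq_zero.1 this).resolve_left (hτ i)
  set s : ℝ := ∑ i : E, |(e i : ℝ)| with hs
  have hs0 : 0 < s := by
    refine lt_of_le_of_ne (Finset.sum_nonneg fun i _ => abs_nonneg _) fun h => ?_
    have h0 := (Finset.sum_eq_zero_iff_of_nonneg fun i _ => abs_nonneg _).1 h.symm
    have : (fun j => (D j : ℝ)) = 0 := hE _ fun i hi => by
      rw [hcast]
      exact abs_eq_zero.1 (h0 ⟨i, hi⟩ (Finset.mem_univ _))
    obtain ⟨j, hj⟩ := hD
    apply hj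
    have := congrFun this j
    simp only [Pi.zero_apply, Int.cast_eq_zero] at this
    simp [this]
  have hsign : ∀ a : ℤ, ((a.sign : ℤ) : ℝ) * a = |(a : ℝ)| := by
    intro a
    rw [← Int.cast_mul, Int.sign_mul_self_eq_abs]
    push_cast
    rfl
  have hτe : ∀ i, τ i * (e i : ℝ) = |(e i : ℝ)| := by
    intro i
    by_cases h : e i = 0
    · simp [h]
    · simp only [τ, h, if_false, hsign]
  let l : Option E → ℝ := fun k => Option.casesOn k 1 (fun _ => 0)
  -- Row `none` slices the cone at total size 1. The bound 2 only makes the slice a box; it is never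
  -- attained, so tight rows of E vanish at the vertex.
  let h : Option E → ℝ := fun k => Option.casesOn k 1 (fun i => if e i = 0 then 0 else 2)
  obtain ⟨x, hx, hxt⟩ := exists_vertex f hfspan l h (s⁻¹ • fun j => (D j : ℝ)) (by
    rintro (_ | i)
    · rw [hfn]
      have : ∑ i : E, ((e i).sign : ℝ) * (MR *ᵥ (s⁻¹ • fun j => (D j : ℝ))) i = 1 := by
        simp only [Matrix.mulVec_smul, Pi.smul_apply, smul_eq_mul, hcast]
        rw [← inv_mul_cancel₀ hs0.ne', hs, Finset.mul_sum]
        refine Finset.sum_congr rfl fun i _ => ?_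
        rw [← hsign]
        ring
      rw [this]
      exact ⟨le_refl _, le_refl _⟩
    · rw [hfs]
      simp only [Matrix.mulVec_smul, Pi.smul_apply, smul_eq_mul, hcast]
      have h1 : τ i * (s⁻¹ * (e i : ℝ)) = |(e i : ℝ)| / s := by
        rw [← hτe]; ring
      rw [h1]
      refine ⟨by positivity, ?_⟩
      by_cases h0 : e i = 0
      · simp [h, h0]
      · simp only [h, h0, if_false]
        have : |(e i : ℝ)| ≤ s := Finset.single_le_sum
          (f := fun i : E => |(e i : ℝ)|) (fun i _ => abs_nonneg _) (Finset.mem_univ i)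
        have := div_le_one_of_le₀ this hs0.le
        linarith)
  have hsum : ∑ i : E, ((e i).sign : ℝ) * (MR *ᵥ x) i = 1 := by
    rw [← hfn]
    exact le_antisymm (hx none).2 (hx none).1
  have hzero : ∀ i : E, e i = 0 → (MR *ᵥ x) i = 0 := by
    intro i hi
    have h1 := hx (some i)
    rw [hfs] at h1
    simp only [l, h, hi, if_true, τ, one_mul] at h1
    exact le_antisymm h1.2 h1.1
  have hnonneg : ∀ i : E, 0 ≤ τ i * (MR *ᵥ x) i := by
    intro i
    have h1 := (hx (some i)).1
    rwa [hfs] at h1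
  have hst : ∀ i : E, ((e i).sign : ℝ) * (MR *ᵥ x) i = τ i * (MR *ᵥ x) i := by
    intro i
    by_cases hi : e i = 0
    · simp [hzero i hi]
    · simp [τ, hi]
  have htight : ∀ i : E, ((f *ᵥ x) (some i) = l (some i) ∨ (f *ᵥ x) (some i) = h (some i)) →
      (MR *ᵥ x) i = 0 := by
    intro i hi
    by_cases h0 : e i = 0
    · exact hzero i h0
    rw [hfs] at hi
    simp only [l, h, h0, if_false] at hi
    rcases hi with hi | hi
    · exact (mul_eq_zero.1 hi).resolve_left (hτ i)
    · have : τ i * (MR *ᵥ x) i ≤ ∑ i : E, ((e i).sign : ℝ) * (MR *ᵥ x) i := by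
        rw [Finset.sum_congr rfl fun i _ => hst i]
        exact Finset.single_le_sum (f := fun i : E => τ i * (MR *ᵥ x) i)
          (fun i _ => hnonneg i) (Finset.mem_univ i)
      rw [hsum, hi] at this
      norm_num at this
  obtain ⟨⟨i₀, hi₀E⟩, -, hi₀⟩ := Finset.exists_ne_zero_of_sum_ne_zero (by
    rw [hsum]; exact one_ne_zero)
  have hi₀x : (MR *ᵥ x) i₀ ≠ 0 := right_ne_zero_of_mul hi₀
  -- At a vertex of the slice, vectors killed by the vanishing rows of E are multiples of x; the row
  -- `i₀`, nonzero at x, excludes these as well.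
  have hspan : RowsSpan MR (insert i₀ {i | i ∈ E ∧ (MR *ᵥ x) i = 0}) := by
    intro u hu
    have h0 : u - (∑ i : E, ((e i).sign : ℝ) * (MR *ᵥ u) i) • x = 0 := by
      refine hxt _ ?_
      rintro (_ | i) hi
      · rw [Matrix.mulVec_sub, Matrix.mulVec_smul, Pi.sub_apply, Pi.smul_apply, hfn, hfn, hsum]
        simp
      · have h1 := htight i hi
        rw [hfs, Matrix.mulVec_sub, Matrix.mulVec_smul, Pi.sub_apply, Pi.smul_apply, h1,
          hu i (Or.inr ⟨i.2, h1⟩)]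
        simp
    rw [sub_eq_zero] at h0
    have h1 := hu i₀ (Or.inl rfl)
    rw [h0, Matrix.mulVec_smul, Pi.smul_apply, smul_eq_mul] at h1
    rw [h0, (mul_eq_zero.1 h1).resolve_right hi₀x, zero_smul]
  obtain ⟨r, hrS, hrdet⟩ := hspan.exists_det_ne_zero
  have hrE : ∀ k, r k ∈ E := fun k => by
    rcases hrS k with hk | hk
    · rw [hk]; exact hi₀E
    · exact hk.1
  set N : Matrix (Fin n) (Fin n) ℤ := M.submatrix r id with hN
  have hNR : MR.submatrix r id = N.map (Int.cast : ℤ → ℝ) := by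
    ext; simp [hMR, hN]
  have hdetne : N.det ≠ 0 := by
    intro h0
    apply hrdet
    rw [hNR, ← Int.cast_det, h0, Int.cast_zero]
  have heven : ∀ r' : Fin n → ι, (∀ k, r' k ∈ E) → 2 ∣ (M.submatrix r' id).det := fun r' hr' =>
    two_dvd_det_of_mulVec _ D hD fun k => hr' k
  have hdet2 : N.det.natAbs = 2 := by
    have h1 : N.det.natAbs ≤ 2 := hM r
    have h2 : 2 ∣ N.det := heven r hrE
    omega
  obtain ⟨k₀, hk₀⟩ : ∃ k, r k = i₀ := by
    by_contra hne
    push Not at hne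
    have : x = 0 := Matrix.eq_zero_of_mulVec_eq_zero hrdet (by
      ext k
      exact ((hrS k).resolve_left (hne k)).2)
    rw [this] at hi₀x
    simp at hi₀x
  have hrk : ∀ k, k ≠ k₀ → (MR *ᵥ x) (r k) = 0 := fun k hk => by
    rcases hrS k with h1 | h1
    · refine (hdetne (Matrix.det_zero_of_row_eq hk ?_)).elim
      ext j
      simp [hN, h1, hk₀]
    · exact h1.2
  -- On the rows of N this vector is det N in row `k₀` and 0 elsewhere, so it is an integral vector
  -- on the line of x.
  let X₀ : Fin n → ℤ := fun j => N.adjugate j k₀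
  have hX₀ : ∀ i, (M *ᵥ X₀) i = (M.submatrix (Function.update r k₀ i) id).det :=
    mulVec_adjugate_col M r k₀
  have hX₀i : (M *ᵥ X₀) i₀ = N.det := by
    rw [hX₀, ← hk₀, Function.update_eq_self]
  have hX₀E : ∀ i ∈ E, 2 ∣ (M *ᵥ X₀) i := fun i hi => by
    rw [hX₀]
    refine heven _ fun k => ?_
    by_cases hk : k = k₀
    · subst hk; simpa using hi
    · simpa [hk] using hrE k
  have hX₀le : ∀ i, ((M *ᵥ X₀) i).natAbs ≤ 2 := fun i => by
    rw [hX₀]; exact hM _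
  set t : ℝ := N.det / (MR *ᵥ x) i₀ with ht
  have ht0 : t ≠ 0 := div_ne_zero (by exact_mod_cast hdetne) hi₀x
  have hX₀x : (fun j => (X₀ j : ℝ)) = t • x := by
    rw [← sub_eq_zero]
    refine Matrix.eq_zero_of_mulVec_eq_zero hrdet ?_
    ext k
    change (MR *ᵥ _) (r k) = 0
    rw [Matrix.mulVec_sub, Matrix.mulVec_smul, Pi.sub_apply, Pi.smul_apply, hcast]
    by_cases hk : k = k₀
    · subst hk
      rw [hk₀, hX₀i, smul_eq_mul, ht]
      field_simp
      simp
    · rw [hrk k hk, hX₀, Matrix.det_zero_of_row_eq hk]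
      · simp
      · ext j; simp [hk]
  obtain ⟨X, q, hq, hXq, hX⟩ : ∃ (X : Fin n → ℤ) (q : ℝ), 0 < q ∧
      (fun j => (X j : ℝ)) = q • x ∧ (X = X₀ ∨ X = -X₀) := by
    rcases lt_or_gt_of_ne ht0 with h1 | h1
    · refine ⟨-X₀, -t, by linarith, ?_, Or.inr rfl⟩
      rw [neg_smul, ← hX₀x]
      ext j; simp
    · exact ⟨X₀, t, h1, hX₀x, Or.inl rfl⟩
  have hMX : ∀ i, (M *ᵥ X) i = (M *ᵥ X₀) i ∨ (M *ᵥ X) i = -(M *ᵥ X₀) i := fun i => by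
    rcases hX with rfl | rfl
    · exact Or.inl rfl
    · right; rw [Matrix.mulVec_neg]; rfl
  have hXeven : ∀ i ∈ E, 2 ∣ (M *ᵥ X) i := fun i hi => by
    have := hX₀E i hi
    rcases hMX i with h1 | h1 <;> omega
  have hXle : ∀ i, |(M *ᵥ X) i| ≤ 2 := fun i => by
    have := hX₀le i
    rw [abs_le]
    rcases hMX i with h1 | h1 <;> omega
  refine ⟨X, ⟨i₀, hi₀E, ?_⟩, hXle, fun i hi => ?_, ?_⟩
  · rcases hMX i₀ with h1 | h1 <;> rw [h1, hX₀i]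
    · exact hdetne
    · exact neg_ne_zero.2 hdetne
  · have h1 : ((M *ᵥ X) i : ℝ) = q * (MR *ᵥ x) i := by
      rw [← hcast, hXq, Matrix.mulVec_smul]; rfl
    have h2 := hnonneg ⟨i, hi⟩
    have h3 := hzero ⟨i, hi⟩
    -- Both entries are even and the one of MX is at most 2 in size, so for `e i ≠ 0` agreement in
    -- sign already implies conformality.
    have h4 := hXeven i hi
    have h5 := abs_le.1 (hXle i)
    have hi' : 2 ∣ e i := hi
    rcases lt_trichotomy (e i) 0 with h6 | h6 | h6
    · have h7 : (MR *ᵥ x) i ≤ 0 := by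
        simpa [τ, h6.ne, Int.sign_eq_neg_one_of_neg h6] using h2
      have h8 : (M *ᵥ X) i ≤ 0 := by
        have : ((M *ᵥ X) i : ℝ) ≤ 0 := by
          rw [h1]; exact mul_nonpos_of_nonneg_of_nonpos hq.le h7
        exact_mod_cast this
      right; omega
    · have h8 : (M *ᵥ X) i = 0 := by
        have : ((M *ᵥ X) i : ℝ) = 0 := by rw [h1, h3 h6, mul_zero]
        exact_mod_cast this
      left; omega
    · have h7 : 0 ≤ (MR *ᵥ x) i := by
        simpa [τ, h6.ne', Int.sign_eq_one_of_pos h6] using h2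
      have h8 : 0 ≤ (M *ᵥ X) i := by
        have : 0 ≤ ((M *ᵥ X) i : ℝ) := by
          rw [h1]; exact mul_nonneg hq.le h7
        exact_mod_cast this
      left; omega
  · exact even_or_congr_of_mulVec_even N hdet2 X D hD (fun k => hXeven _ (hrE k))
      fun k => hrE k

/-- Every half-integral vector `D / 2` admits a conformal vector `G / 2` in its class modulo `ℤⁿ`
on which all rows of `M` are small. -/
theorem exists_odd_conformal {ι : Type*} [Fintype ι] {n : ℕ} (M : Matrix ι (Fin n) ℤ)
    (hM : ∀ r : Fin n → ι, (M.submatrix r id).det.natAbs ≤ 2) (D : Fin n → ℤ)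
    (hD : ∃ j, ¬ 2 ∣ D j)
    (hE : RowsSpan (M.map (Int.cast : ℤ → ℝ)) {i | 2 ∣ (M *ᵥ D) i}) :
    ∃ G : Fin n → ℤ, (∀ j, 2 ∣ D j - G j) ∧ (∀ i, |(M *ᵥ G) i| ≤ 2) ∧
      (∀ i, 2 ∣ (M *ᵥ D) i → IsConformal ((M *ᵥ G) i) ((M *ᵥ D) i)) := by
  classical
  induction hk : ∑ i with 2 ∣ (M *ᵥ D) i, ((M *ᵥ D) i).natAbs using Nat.strong_induction_on
    generalizing D with
  | _ k ih =>
    obtain ⟨X, ⟨i₀, hi₀, hXi₀⟩, hXle, hXc, hX | hX⟩ := exists_elementary_conformal M hM D hD hE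
    swap
    · exact ⟨X, hX, hXle, hXc⟩
    have hMX : ∀ i, 2 ∣ (M *ᵥ X) i := dvd_mulVec M X hX
    have hsub : ∀ i, (M *ᵥ (D - X)) i = (M *ᵥ D) i - (M *ᵥ X) i := fun i => by
      rw [Matrix.mulVec_sub]; rfl
    have hiff : ∀ i, 2 ∣ (M *ᵥ (D - X)) i ↔ 2 ∣ (M *ᵥ D) i := fun i => by
      have := hMX i
      rw [hsub]
      omega
    -- Subtracting an even conformal X preserves E and shrinks the sizes on E, strictly at `i₀`.
    have hlt : ∑ i with 2 ∣ (M *ᵥ (D - X)) i, ((M *ᵥ (D - X)) i).natAbs < k := by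
      rw [← hk, Finset.filter_congr fun i _ => hiff i]
      refine Finset.sum_lt_sum (fun i hi => ?_) ⟨i₀, by simpa using hi₀, ?_⟩
      · have := hXc i (Finset.mem_filter.1 hi).2
        rw [hsub]
        unfold IsConformal at this
        omega
      · have := hXc i₀ hi₀
        rw [hsub]
        unfold IsConformal at this
        omega
    obtain ⟨G, hG, hGle, hGc⟩ := ih _ hlt (D - X) (by
      obtain ⟨j, hj⟩ := hD
      refine ⟨j, ?_⟩
      have := hX j
      simp only [Pi.sub_apply]
      omega) (by simpa only [hiff] using hE) rfl
    refine ⟨G, fun j => ?_, hGle, fun i hi => ?_⟩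
    · have h1 := hG j
      have h2 := hX j
      simp only [Pi.sub_apply] at h1
      omega
    · have h1 := hGc i ((hiff i).2 hi)
      have h2 := hXc i hi
      rw [hsub] at h1
      unfold IsConformal at *
      omega

/-! ### Rounding optimal solutions of the linear relaxation -/

section Relaxation

variable {m n : ℕ} {A : Matrix (Fin m) (Fin n) ℤ} {b : Fin m → ℤ} {c : Fin n → ℝ}

theorem map_mulVec_intCast {ι : Type*} (M : Matrix ι (Fin n) ℤ) (Y : Fin n → ℤ) (i : ι) :
    (M.map (Int.cast : ℤ → ℝ) *ᵥ fun j => (Y j : ℝ)) i = ((M *ᵥ Y) i : ℝ) := by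
  simp [Matrix.mulVec, dotProduct]

theorem withUnitRows_mulVec_inl (x : Fin n → ℝ) (i : Fin m) :
    ((withUnitRows A).map (Int.cast : ℤ → ℝ) *ᵥ x) (Sum.inl i) =
      (A.map (Int.cast : ℤ → ℝ) *ᵥ x) i := by
  simp [Matrix.mulVec, dotProduct]

theorem withUnitRows_mulVec_inr (x : Fin n → ℝ) (j : Fin n) :
    ((withUnitRows A).map (Int.cast : ℤ → ℝ) *ᵥ x) (Sum.inr j) = x j := by
  simp [Matrix.mulVec, dotProduct, Matrix.one_apply]

theorem withUnitRows_mulVec_int_inl (X : Fin n → ℤ) (i : Fin m) :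
    (withUnitRows A *ᵥ X) (Sum.inl i) = (A *ᵥ X) i := by
  simp [Matrix.fromRows_mulVec]

theorem withUnitRows_mulVec_int_inr (X : Fin n → ℤ) (j : Fin n) :
    (withUnitRows A *ᵥ X) (Sum.inr j) = X j := by
  simp [Matrix.fromRows_mulVec]

theorem mem_mipFeasible_empty {x : Fin n → ℝ} :
    x ∈ mipFeasible A b ∅ ↔ ∀ i, (A.map (Int.cast : ℤ → ℝ) *ᵥ x) i ≤ (b i : ℝ) := by
  simp [mipFeasible]

theorem intCast_mem_mipFeasible_univ {X : Fin n → ℤ} (hX : ∀ i, (A *ᵥ X) i ≤ b i) :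
    (fun j => (X j : ℝ)) ∈ mipFeasible A b Set.univ :=
  ⟨fun i => by rw [map_mulVec_intCast]; exact_mod_cast hX i, fun j _ => ⟨X j, rfl⟩⟩

theorem mipFeasible_univ_subset : mipFeasible A b Set.univ ⊆ mipFeasible A b ∅ :=
  fun _ hx => mem_mipFeasible_empty.2 hx.1

theorem exists_intCast_of_mem_mipFeasible_univ {x : Fin n → ℝ}
    (hx : x ∈ mipFeasible A b Set.univ) :
    ∃ X : Fin n → ℤ, x = (fun j => (X j : ℝ)) ∧ ∀ i, (A *ᵥ X) i ≤ b i := by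
  choose X hX using fun j => hx.2 j (Set.mem_univ j)
  obtain rfl : x = fun j => (X j : ℝ) := funext hX
  refine ⟨X, rfl, fun i => ?_⟩
  have := hx.1 i
  rw [map_mulVec_intCast] at this
  exact_mod_cast this

/-- A linear objective does not increase along a feasible direction at an optimal solution. -/
theorem IsMIPOptimal.dotProduct_nonpos {x u : Fin n → ℝ} (hx : IsMIPOptimal A b c ∅ x)
    (hu : ∀ i, (A.map (Int.cast : ℤ → ℝ) *ᵥ x) i = b i →
      (A.map (Int.cast : ℤ → ℝ) *ᵥ u) i ≤ 0) : c ⬝ᵥ u ≤ 0 := by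
  have hxf := mem_mipFeasible_empty.1 hx.1
  have hev : ∀ᶠ ε in nhdsWithin (0 : ℝ) (Set.Ioi 0), ∀ i,
      (A.map (Int.cast : ℤ → ℝ) *ᵥ (x + ε • u)) i ≤ b i := by
    rw [Filter.eventually_all]
    intro i
    simp only [Matrix.mulVec_add, Matrix.mulVec_smul, Pi.add_apply, Pi.smul_apply, smul_eq_mul]
    by_cases hi : (A.map (Int.cast : ℤ → ℝ) *ᵥ x) i = b i
    · filter_upwards [self_mem_nhdsWithin] with ε hε
      have := mul_nonpos_of_nonneg_of_nonpos (le_of_lt hε) (hu i hi)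
      linarith
    · have hlt := lt_of_le_of_ne (hxf i) hi
      generalize (A.map (Int.cast : ℤ → ℝ) *ᵥ x) i = p at hlt
      generalize (A.map (Int.cast : ℤ → ℝ) *ᵥ u) i = q
      have hcont : Continuous fun ε : ℝ => p + ε * q := by fun_prop
      have ht : Filter.Tendsto (fun ε : ℝ => p + ε * q) (nhds 0) (nhds p) := by
        simpa using hcont.tendsto 0
      filter_upwards [nhdsWithin_le_nhds (ht.eventually_lt_const hlt)] with ε hε
      exact hε.le
  obtain ⟨ε, hf, hε⟩ := (hev.and self_mem_nhdsWithin).exists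
  have h1 := hx.2 _ (mem_mipFeasible_empty.2 hf)
  rw [dotProduct_add, dotProduct_smul, smul_eq_mul] at h1
  have hε' : 0 < ε := hε
  by_contra hcon
  push Not at hcon
  have := mul_pos hε' hcon
  linarith

theorem eventually_floor_le_extension_le_ceil (w v : ℝ) (h1 : (⌊w⌋ : ℝ) ≤ v) (h2 : v ≤ ⌈w⌉) :
    ∀ᶠ ε in nhdsWithin (0 : ℝ) (Set.Ioi 0),
      (⌊w⌋ : ℝ) ≤ w + ε * (w - v) ∧ w + ε * (w - v) ≤ ⌈w⌉ := by
  by_cases hw : (⌊w⌋ : ℝ) = w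
  · have hc : (⌈w⌉ : ℝ) = w := by rw [← hw]; simp
    have hv : v = w := le_antisymm (hc ▸ h2) (hw ▸ h1)
    filter_upwards with ε
    rw [hw, hc, hv]
    simp
  · have hlt : (⌊w⌋ : ℝ) < w := lt_of_le_of_ne (Int.floor_le w) hw
    have hlt' : w < (⌈w⌉ : ℝ) := by
      refine lt_of_le_of_ne (Int.le_ceil w) fun h => hw ?_
      rw [h]; simp
    have hcont : Continuous fun ε : ℝ => w + ε * (w - v) := by fun_prop
    have ht : Filter.Tendsto (fun ε : ℝ => w + ε * (w - v)) (nhds 0) (nhds w) := by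
      simpa using hcont.tendsto 0
    filter_upwards [nhdsWithin_le_nhds (ht.eventually_const_lt hlt),
      nhdsWithin_le_nhds (ht.eventually_lt_const hlt')] with ε h3 h4
    exact ⟨h3.le, h4.le⟩

/-- Every optimal solution `w` of the linear relaxation can be rounded to an optimal solution `v`
at which enough rows take integral values to determine `v`. -/
theorem IsMIPOptimal.exists_rounding {w : Fin n → ℝ} (hw : IsMIPOptimal A b c ∅ w) :
    ∃ v, IsMIPOptimal A b c ∅ v ∧ (∀ j, (⌊w j⌋ : ℝ) ≤ v j ∧ v j ≤ ⌈w j⌉) ∧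
      RowsSpan ((withUnitRows A).map (Int.cast : ℤ → ℝ))
        {i | ∃ k : ℤ, ((withUnitRows A).map (Int.cast : ℤ → ℝ) *ᵥ v) i = k} ∧
      ∃ ε : ℝ, 0 < ε ∧ IsMIPOptimal A b c ∅ (w + ε • (w - v)) ∧
        ∀ j, (⌊w j⌋ : ℝ) ≤ w j + ε * (w j - v j) ∧ w j + ε * (w j - v j) ≤ ⌈w j⌉ := by
  have hwf := mem_mipFeasible_empty.1 hw.1
  set MR := (withUnitRows A).map (Int.cast : ℤ → ℝ) with hMR
  have hspan : RowsSpan MR Set.univ := fun u hu => funext fun j => by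
    rw [← withUnitRows_mulVec_inr (A := A) u j]
    exact hu _ (Set.mem_univ _)
  obtain ⟨v, hv, hvt⟩ := exists_vertex MR hspan (fun i => (⌊(MR *ᵥ w) i⌋ : ℝ))
    (fun i => (⌈(MR *ᵥ w) i⌉ : ℝ)) w fun i => ⟨Int.floor_le _, Int.le_ceil _⟩
  -- As b is integral, Aw ≤ b implies ⌈Aw⌉ ≤ b.
  have hbox : ∀ x : Fin n → ℝ, (∀ i, (MR *ᵥ x) i ≤ ⌈(MR *ᵥ w) i⌉) → x ∈ mipFeasible A b ∅ := by
    intro x hx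
    refine mem_mipFeasible_empty.2 fun i => ?_
    have h1 := hx (Sum.inl i)
    rw [hMR, withUnitRows_mulVec_inl, withUnitRows_mulVec_inl] at h1
    exact h1.trans (by exact_mod_cast Int.ceil_le.2 (hwf i))
  have hvf := hbox v fun i => (hv i).2
  have hev : ∀ᶠ ε in nhdsWithin (0 : ℝ) (Set.Ioi 0), ∀ i,
      (⌊(MR *ᵥ w) i⌋ : ℝ) ≤ (MR *ᵥ (w + ε • (w - v))) i ∧
        (MR *ᵥ (w + ε • (w - v))) i ≤ ⌈(MR *ᵥ w) i⌉ := by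
    rw [Filter.eventually_all]
    intro i
    simp only [Matrix.mulVec_add, Matrix.mulVec_smul, Matrix.mulVec_sub, Pi.add_apply,
      Pi.smul_apply, Pi.sub_apply, smul_eq_mul]
    exact eventually_floor_le_extension_le_ceil _ _ (hv i).1 (hv i).2
  obtain ⟨ε, hf, hε⟩ := (hev.and self_mem_nhdsWithin).exists
  have hε' : 0 < ε := hε
  have hyf := hbox _ fun i => (hf i).2
  -- The segment from v to w extends feasibly beyond w, so c cannot increase from v to w.
  have hcv : c ⬝ᵥ v = c ⬝ᵥ w := by
    refine le_antisymm (hw.2 v hvf) ?_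
    have h1 := hw.2 _ hyf
    rw [dotProduct_add, dotProduct_smul, smul_eq_mul, dotProduct_sub] at h1
    by_contra hcon
    push Not at hcon
    have := mul_pos hε' (sub_pos.2 hcon)
    linarith
  refine ⟨v, ⟨hvf, fun y hy => hcv ▸ hw.2 y hy⟩, fun j => ?_, ?_, ε, hε', ⟨hyf, fun y hy => ?_⟩,
    fun j => ?_⟩
  · have := hv (Sum.inr j)
    simpa only [hMR, withUnitRows_mulVec_inr] using this
  · intro u hu
    refine hvt u fun i hi => hu i ?_
    rcases hi with hi | hi
    · exact ⟨_, hi⟩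
    · exact ⟨_, hi⟩
  · rw [dotProduct_add, dotProduct_smul, dotProduct_sub, hcv, sub_self, smul_zero, add_zero]
    exact hw.2 y hy
  · have := hf (Sum.inr j)
    simpa only [hMR, withUnitRows_mulVec_inr, Pi.add_apply, Pi.smul_apply, Pi.sub_apply,
      smul_eq_mul] using this

/-- Cramer's rule for a nonsingular system with integral right-hand side; k is its determinant. -/
theorem RowsSpan.exists_int_mul_eq {ι : Type*} {M : Matrix ι (Fin n) ℤ} {v : Fin n → ℝ} {d : ℕ}
    (hM : ∀ r : Fin n → ι, (M.submatrix r id).det.natAbs ≤ d)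
    (h : RowsSpan (M.map (Int.cast : ℤ → ℝ))
      {i | ∃ k : ℤ, (M.map (Int.cast : ℤ → ℝ) *ᵥ v) i = k}) :
    ∃ k : ℤ, k ≠ 0 ∧ k.natAbs ≤ d ∧ ∃ V : Fin n → ℤ, ∀ j, k * v j = V j := by
  obtain ⟨r, hr, hdet⟩ := h.exists_det_ne_zero
  choose β hβ using hr
  set N := M.submatrix r id with hN
  have hNR : (M.map (Int.cast : ℤ → ℝ)).submatrix r id = N.map (Int.cast : ℤ → ℝ) := by
    ext; simp [hN]
  rw [hNR, ← Int.cast_det] at hdet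
  refine ⟨N.det, by exact_mod_cast hdet, hM r, N.adjugate *ᵥ β, fun j => ?_⟩
  have h1 : N.map (Int.cast : ℤ → ℝ) *ᵥ v = fun k => (β k : ℝ) := by
    rw [← hNR]
    exact funext hβ
  have hadj : (N.map (Int.cast : ℤ → ℝ)).adjugate = N.adjugate.map (Int.cast : ℤ → ℝ) :=
    ((Int.castRingHom ℝ).map_adjugate N).symm
  rw [← map_mulVec_intCast, ← h1, ← hadj, Matrix.mulVec_mulVec, Matrix.adjugate_mul,
    ← Int.cast_det, Matrix.smul_mulVec, Matrix.one_mulVec, Pi.smul_apply, smul_eq_mul]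

end Relaxation

/-! ### Proximity in both directions -/

section Proximity

variable {m n : ℕ} {A : Matrix (Fin m) (Fin n) ℤ} {b : Fin m → ℤ} {c : Fin n → ℝ}

theorem norm_le_of_forall_abs_le {x : Fin n → ℝ} {r : ℝ} (hr : 0 ≤ r) (h : ∀ j, |x j| ≤ r) :
    ‖x‖ ≤ r := (pi_norm_le_iff_of_nonneg hr).2 h

/-- The rounding of an optimal solution of the linear relaxation is half-integral. -/
theorem RowsSpan.exists_half_integral (h1 : 1 ≤ maxSubdet A) (h2 : maxSubdet A ≤ 2)
    {v : Fin n → ℝ}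
    (h : RowsSpan ((withUnitRows A).map (Int.cast : ℤ → ℝ))
      {i | ∃ k : ℤ, ((withUnitRows A).map (Int.cast : ℤ → ℝ) *ᵥ v) i = k}) :
    ∃ V : Fin n → ℤ, v = (fun j => (V j : ℝ) / 2) ∧ (maxSubdet A = 1 → ∀ j, 2 ∣ V j) ∧
      RowsSpan ((withUnitRows A).map (Int.cast : ℤ → ℝ))
        {i | 2 ∣ (withUnitRows A *ᵥ V) i} := by
  obtain ⟨k, hk0, hk, V, hV⟩ := h.exists_int_mul_eq
    fun r => natAbs_det_submatrix_withUnitRows_le A h1 n r id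
  obtain ⟨U, hU, hUeven⟩ : ∃ U : Fin n → ℤ, v = (fun j => (U j : ℝ) / 2) ∧
      (maxSubdet A = 1 → ∀ j, 2 ∣ U j) := by
    have hcases : k = 1 ∨ k = -1 ∨ (maxSubdet A ≠ 1 ∧ (k = 2 ∨ k = -2)) := by omega
    rcases hcases with rfl | rfl | ⟨hne, rfl | rfl⟩
    · exact ⟨fun j => 2 * V j, funext fun j => by have := hV j; push_cast at *; linarith,
        fun _ j => dvd_mul_right _ _⟩
    · exact ⟨fun j => -(2 * V j), funext fun j => by have := hV j; push_cast at *; linarith,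
        fun _ j => (dvd_mul_right _ _).neg_right⟩
    · exact ⟨V, funext fun j => by have := hV j; push_cast at *; linarith,
        fun h => (hne h).elim⟩
    · exact ⟨fun j => -V j, funext fun j => by have := hV j; push_cast at *; linarith,
        fun h => (hne h).elim⟩
  refine ⟨U, hU, hUeven, fun u hu => h u fun i hi => hu i ?_⟩
  obtain ⟨q, hq⟩ := hi
  have h3 : v = (1 / 2 : ℝ) • fun j => (U j : ℝ) := by
    rw [hU]; ext j; simp; ring
  rw [h3, Matrix.mulVec_smul, Pi.smul_apply, map_mulVec_intCast, smul_eq_mul] at hq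
  refine ⟨q, ?_⟩
  have : (((withUnitRows A *ᵥ U) i : ℤ) : ℝ) = ((2 * q : ℤ) : ℝ) := by
    push_cast; linarith
  exact_mod_cast this

theorem map_mulVec_intCast_div {ι : Type*} (M : Matrix ι (Fin n) ℤ) (Y : Fin n → ℤ) (q : ℝ)
    (i : ι) :
    (M.map (Int.cast : ℤ → ℝ) *ᵥ fun j => (Y j : ℝ) / q) i = ((M *ᵥ Y) i : ℝ) / q := by
  have : (fun j => (Y j : ℝ) / q) = q⁻¹ • fun j => (Y j : ℝ) := by
    ext j; simp; ring
  rw [this, Matrix.mulVec_smul, Pi.smul_apply, map_mulVec_intCast, smul_eq_mul]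
  ring

/-- The witness is v itself if integral, and otherwise v + G/2 = y − H. -/
theorem exists_integer_optimal_near (h1 : 1 ≤ maxSubdet A) (h2 : maxSubdet A ≤ 2)
    {y w : Fin n → ℝ} (hy : IsMIPOptimal A b c Set.univ y) (hw : IsMIPOptimal A b c ∅ w) :
    ∃ z, IsMIPOptimal A b c Set.univ z ∧ ‖w - z‖ ≤ (maxSubdet A : ℝ) := by
  obtain ⟨v, hv, hvw, hspan, -⟩ := hw.exists_rounding
  obtain ⟨V, hV, hVeven, hspan⟩ := hspan.exists_half_integral h1 h2
  have hvw' : ∀ j, |w j - v j| ≤ 1 := fun j => by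
    have h3 := hvw j
    have h4 := Int.ceil_le_floor_add_one (w j)
    have h5 : (⌈w j⌉ : ℝ) ≤ ⌊w j⌋ + 1 := by exact_mod_cast h4
    have h6 := Int.floor_le (w j)
    have h7 := Int.le_ceil (w j)
    rw [abs_le]
    constructor <;> linarith
  have h1' : (1 : ℝ) ≤ maxSubdet A := by exact_mod_cast h1
  have hvf : ∀ i, (A *ᵥ V) i ≤ 2 * b i := fun i => by
    have := mem_mipFeasible_empty.1 hv.1 i
    rw [hV, map_mulVec_intCast_div] at this
    have : ((A *ᵥ V) i : ℝ) ≤ ((2 * b i : ℤ) : ℝ) := by push_cast; linarith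
    exact_mod_cast this
  by_cases hint : ∀ j, 2 ∣ V j
  · choose Z hZ using hint
    have hvZ : v = fun j => (Z j : ℝ) := by
      rw [hV]; ext j; rw [hZ]; push_cast; ring
    refine ⟨v, ⟨⟨mem_mipFeasible_empty.1 hv.1, fun j _ => ⟨Z j, congrFun hvZ j⟩⟩,
      fun x hx => hv.2 x (mipFeasible_univ_subset hx)⟩, ?_⟩
    exact norm_le_of_forall_abs_le (by positivity) fun j => (hvw' j).trans h1'
  have hΔ : maxSubdet A = 2 := by
    have : maxSubdet A ≠ 1 := fun h => hint (hVeven h)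
    omega
  obtain ⟨Y, rfl, hYf⟩ := exists_intCast_of_mem_mipFeasible_univ hy.1
  let D : Fin n → ℤ := (2 : ℤ) • Y - V
  have hD : ∀ {ι : Type} (M : Matrix ι (Fin n) ℤ) i,
      (M *ᵥ D) i = 2 * (M *ᵥ Y) i - (M *ᵥ V) i := fun M i => by
    simp only [D, Matrix.mulVec_sub, Matrix.mulVec_smul, Pi.sub_apply, Pi.smul_apply, smul_eq_mul]
  obtain ⟨G, hG, hGle, hGc⟩ := exists_odd_conformal (withUnitRows A)
    (fun r => (natAbs_det_submatrix_withUnitRows_le A h1 n r id).trans h2) D (by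
      push Not at hint
      obtain ⟨j, hj⟩ := hint
      refine ⟨j, ?_⟩
      simp only [D, Pi.sub_apply, Pi.smul_apply, smul_eq_mul]
      omega) (by
      convert hspan using 3 with i
      rw [hD]
      omega)
  choose H hH using hG
  have hDGH : D = G + (2 : ℤ) • H := by
    ext j
    have := hH j
    simp only [Pi.add_apply, Pi.smul_apply, smul_eq_mul]
    omega
  have hDH : ∀ i, (A *ᵥ D) i = (A *ᵥ G) i + 2 * (A *ᵥ H) i := fun i => by
    rw [hDGH]
    simp only [Matrix.mulVec_add, Matrix.mulVec_smul, Pi.add_apply, Pi.smul_apply, smul_eq_mul]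
  have hZ : ∀ i, (A *ᵥ (Y - H)) i = (A *ᵥ Y) i - (A *ᵥ H) i := fun i => by
    rw [Matrix.mulVec_sub]; rfl
  have hrow : ∀ i, |(A *ᵥ G) i| ≤ 2 ∧
      (2 ∣ (A *ᵥ D) i → IsConformal ((A *ᵥ G) i) ((A *ᵥ D) i)) := fun i => by
    have h3 := hGle (Sum.inl i)
    have h4 := hGc (Sum.inl i)
    simp only [withUnitRows_mulVec_int_inl] at h3 h4
    exact ⟨h3, h4⟩
  have hZf := intCast_mem_mipFeasible_univ (A := A) (b := b) (X := Y - H) fun i => by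
    have h3 := hD A i
    have h4 := hDH i
    have h5 := hrow i
    have h6 := hvf i
    have h7 := hYf i
    rw [hZ]
    simp only [abs_le, IsConformal] at h5
    omega
  -- A row tight at v has AV = 2b, hence is even with AD ≤ 0; conformality gives AH ≤ 0, so H is a
  -- feasible direction at v.
  have hcH : c ⬝ᵥ (fun j => (H j : ℝ)) ≤ 0 := by
    refine hv.dotProduct_nonpos fun i hi => ?_
    rw [hV, map_mulVec_intCast_div] at hi
    have hi' : ((A *ᵥ V) i : ℝ) = ((2 * b i : ℤ) : ℝ) := by push_cast; linarith
    have h0 : (A *ᵥ V) i = 2 * b i := by exact_mod_cast hi'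
    have h3 := hD A i
    have h4 := hDH i
    have h5 := hrow i
    have h7 := hYf i
    rw [map_mulVec_intCast]
    simp only [IsConformal] at h5
    have : (A *ᵥ H) i ≤ 0 := by omega
    exact_mod_cast this
  refine ⟨_, ⟨hZf, fun x hx => (hy.2 x hx).trans ?_⟩, ?_⟩
  · have : (fun j => (((Y - H) j : ℤ) : ℝ)) = (fun j => (Y j : ℝ)) - fun j => (H j : ℝ) := by
      ext j; simp
    rw [this, dotProduct_sub]
    linarith
  · rw [hΔ]
    refine norm_le_of_forall_abs_le (by positivity) fun j => ?_
    have h3 := hGle (Sum.inr j)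
    rw [withUnitRows_mulVec_int_inr] at h3
    have h3' : |(G j : ℝ)| ≤ 2 := by exact_mod_cast h3
    have h4 := hvw' j
    have h5 : ((Y j - H j : ℤ) : ℝ) = v j + (G j : ℝ) / 2 := by
      have h6 : 2 * (Y j - H j) = V j + G j := by
        have := hH j
        simp only [D, Pi.sub_apply, Pi.smul_apply, smul_eq_mul] at this
        omega
      have h7 : (2 : ℝ) * ((Y j - H j : ℤ) : ℝ) = V j + G j := by exact_mod_cast h6
      rw [hV]
      linarith
    simp only [Pi.sub_apply]
    rw [h5]
    rw [abs_le] at *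
    push_cast
    constructor <;> linarith

theorem isClosed_setOf_isMIPOptimal : IsClosed {x | IsMIPOptimal A b c ∅ x} := by
  have : {x | IsMIPOptimal A b c ∅ x} =
      (⋂ i, {x : Fin n → ℝ | (A.map (Int.cast : ℤ → ℝ) *ᵥ x) i ≤ b i}) ∩
        ⋂ y ∈ mipFeasible A b ∅, {x | c ⬝ᵥ y ≤ c ⬝ᵥ x} := by
    ext x
    simp [IsMIPOptimal, mem_mipFeasible_empty]
  rw [this]
  refine IsClosed.inter (isClosed_iInter fun i => isClosed_le ?_ continuous_const)
    (isClosed_biInter fun y _ => isClosed_le continuous_const ?_)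
  · exact (continuous_apply i).comp (Continuous.matrix_mulVec continuous_const continuous_id)
  · exact Continuous.dotProduct continuous_const continuous_id

theorem exists_isMinOn_sum_abs_sub {F : Set (Fin n → ℝ)} (hF : IsClosed F) (hne : F.Nonempty)
    (w : Fin n → ℝ) : ∃ y ∈ F, ∀ x ∈ F, ∑ j, |y j - w j| ≤ ∑ j, |x j - w j| := by
  obtain ⟨y₁, hy₁⟩ := hne
  have hcont : Continuous fun x : Fin n → ℝ => ∑ j, |x j - w j| := by fun_prop
  have hball : ∀ x : Fin n → ℝ, ∑ j, |x j - w j| ≤ ∑ j, |y₁ j - w j| →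
      x ∈ Metric.closedBall w (∑ j, |y₁ j - w j|) := by
    intro x hx
    rw [mem_closedBall_iff_norm]
    exact norm_le_of_forall_abs_le (Finset.sum_nonneg fun _ _ => abs_nonneg _) fun j =>
      (Finset.single_le_sum (f := fun j => |x j - w j|) (fun _ _ => abs_nonneg _)
        (Finset.mem_univ j)).trans hx
  obtain ⟨y, ⟨hyF, -⟩, hmin⟩ := ((isCompact_closedBall w (∑ j, |y₁ j - w j|)).inter_left
    hF).exists_isMinOn ⟨y₁, hy₁, hball y₁ le_rfl⟩ hcont.continuousOn
  refine ⟨y, hyF, fun x hx => ?_⟩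
  rcases le_total (∑ j, |x j - w j|) (∑ j, |y₁ j - w j|) with h | h
  · exact hmin ⟨hx, hball x h⟩
  · exact (hmin ⟨hy₁, hball y₁ le_rfl⟩ : ∑ j, |y j - w j| ≤ ∑ j, |y₁ j - w j|).trans h

/-- The distance to an integer is affine between consecutive integers. -/
theorem abs_sub_int_extension (k : ℤ) (y v ε : ℝ) (hv : (⌊y⌋ : ℝ) ≤ v ∧ v ≤ ⌈y⌉)
    (he : (⌊y⌋ : ℝ) ≤ y + ε * (y - v) ∧ y + ε * (y - v) ≤ ⌈y⌉) :
    |y + ε * (y - v) - k| + ε * |v - k| = (1 + ε) * |y - k| := by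
  have h1 := Int.floor_le y
  have h2 := Int.le_ceil y
  rcases le_or_gt k ⌊y⌋ with hk | hk
  · have hk' : (k : ℝ) ≤ ⌊y⌋ := by exact_mod_cast hk
    rw [abs_of_nonneg (by linarith), abs_of_nonneg (by linarith), abs_of_nonneg (by linarith)]
    ring
  · have hk' : (⌈y⌉ : ℝ) ≤ k := by
      have h4 := Int.ceil_le_floor_add_one y
      have : ⌈y⌉ ≤ k := by omega
      exact_mod_cast this
    rw [abs_of_nonpos (by linarith), abs_of_nonpos (by linarith), abs_of_nonpos (by linarith)]
    ring

/-- Rounding alone does not bound the distance to w, so an ℓ¹-nearest LP optimum is rounded. -/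
theorem exists_relaxed_optimal_near (h1 : 1 ≤ maxSubdet A) (h2 : maxSubdet A ≤ 2)
    {w : Fin n → ℝ} (hex : ∃ y, IsMIPOptimal A b c ∅ y) (hw : IsMIPOptimal A b c Set.univ w) :
    ∃ z, IsMIPOptimal A b c ∅ z ∧ ‖w - z‖ ≤ (maxSubdet A : ℝ) := by
  obtain ⟨y, hy, hymin⟩ := exists_isMinOn_sum_abs_sub isClosed_setOf_isMIPOptimal hex w
  obtain ⟨v, hv, hvy, hspan, ε, hε, hyε, hbox⟩ := IsMIPOptimal.exists_rounding hy
  obtain ⟨W, rfl, hWf⟩ := exists_intCast_of_mem_mipFeasible_univ hw.1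
  -- The ℓ¹ distance to W is affine on the segment from v through y to its extension. Minimality at
  -- the inner point y makes it constant there.
  have hvmin : ∀ x, IsMIPOptimal A b c ∅ x → ∑ j, |v j - W j| ≤ ∑ j, |x j - W j| := by
    intro x hx
    refine le_trans ?_ (hymin x hx)
    have h3 := hymin _ hyε
    have h4 : ∑ j, |(y + ε • (y - v)) j - W j| + ε * ∑ j, |v j - W j| =
        (1 + ε) * ∑ j, |y j - W j| := by
      rw [Finset.mul_sum, Finset.mul_sum, ← Finset.sum_add_distrib]
      exact Finset.sum_congr rfl fun j _ => abs_sub_int_extension (W j) _ _ _ (hvy j) (hbox j)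
    refine le_of_mul_le_mul_left ?_ hε
    linarith
  obtain ⟨V, hV, -, hspan⟩ := hspan.exists_half_integral h1 h2
  have h1' : (1 : ℝ) ≤ maxSubdet A := by exact_mod_cast h1
  have hvf : ∀ i, (A *ᵥ V) i ≤ 2 * b i := fun i => by
    have := mem_mipFeasible_empty.1 hv.1 i
    rw [hV, map_mulVec_intCast_div] at this
    have : ((A *ᵥ V) i : ℝ) ≤ ((2 * b i : ℤ) : ℝ) := by push_cast; linarith
    exact_mod_cast this
  by_cases hint : ∀ j, 2 ∣ V j
  · choose Z hZ using hint
    have hvZ : v = fun j => (Z j : ℝ) := by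
      rw [hV]; ext j; rw [hZ]; push_cast; ring
    have h3 := hw.2 v ⟨mem_mipFeasible_empty.1 hv.1, fun j _ => ⟨Z j, congrFun hvZ j⟩⟩
    refine ⟨_, ⟨mipFeasible_univ_subset hw.1, fun x hx => (hv.2 x hx).trans h3⟩, ?_⟩
    simp
  let D : Fin n → ℤ := V - (2 : ℤ) • W
  have hD : ∀ {ι : Type} (M : Matrix ι (Fin n) ℤ) i,
      (M *ᵥ D) i = (M *ᵥ V) i - 2 * (M *ᵥ W) i := fun M i => by
    simp only [D, Matrix.mulVec_sub, Matrix.mulVec_smul, Pi.sub_apply, Pi.smul_apply, smul_eq_mul]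
  obtain ⟨G, hG, hGle, hGc⟩ := exists_odd_conformal (withUnitRows A)
    (fun r => (natAbs_det_submatrix_withUnitRows_le A h1 n r id).trans h2) D (by
      push Not at hint
      obtain ⟨j, hj⟩ := hint
      refine ⟨j, ?_⟩
      simp only [D, Pi.sub_apply, Pi.smul_apply, smul_eq_mul]
      omega) (by
      convert hspan using 3 with i
      rw [hD]
      omega)
  choose H hH using hG
  have hDGH : D = G + (2 : ℤ) • H := by
    ext j
    have := hH j
    simp only [Pi.add_apply, Pi.smul_apply, smul_eq_mul]
    omega
  have hDH : ∀ i, (A *ᵥ D) i = (A *ᵥ G) i + 2 * (A *ᵥ H) i := fun i => by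
    rw [hDGH]
    simp only [Matrix.mulVec_add, Matrix.mulVec_smul, Pi.add_apply, Pi.smul_apply, smul_eq_mul]
  have hrow : ∀ i, |(A *ᵥ G) i| ≤ 2 ∧
      (2 ∣ (A *ᵥ D) i → IsConformal ((A *ᵥ G) i) ((A *ᵥ D) i)) := fun i => by
    have h3 := hGle (Sum.inl i)
    have h4 := hGc (Sum.inl i)
    simp only [withUnitRows_mulVec_int_inl] at h3 h4
    exact ⟨h3, h4⟩
  have hcol : ∀ j, |G j| ≤ 2 ∧ (2 ∣ D j → IsConformal (G j) (D j)) := fun j => by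
    have h3 := hGle (Sum.inr j)
    have h4 := hGc (Sum.inr j)
    simp only [withUnitRows_mulVec_int_inr] at h3 h4
    exact ⟨h3, h4⟩
  -- The point W + H = v − G/2 is integer feasible, and −H is a feasible direction at v.
  have hcH : c ⬝ᵥ (fun j => (H j : ℝ)) = 0 := by
    refine le_antisymm ?_ ?_
    · have h3 := hw.2 _ (intCast_mem_mipFeasible_univ (X := W + H) fun i => by
        have h3 := hD A i
        have h4 := hDH i
        have h5 := hrow i
        have h6 := hvf i
        have h7 := hWf i
        rw [Matrix.mulVec_add, Pi.add_apply]
        simp only [abs_le, IsConformal] at h5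
        omega)
      have h4 : (fun j => (((W + H) j : ℤ) : ℝ)) =
          (fun j => (W j : ℝ)) + fun j => (H j : ℝ) := by
        ext j; simp
      rw [h4, dotProduct_add] at h3
      linarith
    · have h3 : c ⬝ᵥ (fun j => ((-H) j : ℝ)) ≤ 0 := by
        refine hv.dotProduct_nonpos fun i hi => ?_
        rw [hV, map_mulVec_intCast_div] at hi
        have hi' : ((A *ᵥ V) i : ℝ) = ((2 * b i : ℤ) : ℝ) := by push_cast; linarith
        have h0 : (A *ᵥ V) i = 2 * b i := by exact_mod_cast hi'
        have h3 := hD A i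
        have h4 := hDH i
        have h5 := hrow i
        have h7 := hWf i
        have h8 := map_mulVec_intCast A (-H) i
        rw [h8, Matrix.mulVec_neg, Pi.neg_apply]
        simp only [IsConformal] at h5
        have : -(A *ᵥ H) i ≤ 0 := by omega
        exact_mod_cast this
      have h4 : (fun j => (((-H) j : ℤ) : ℝ)) = -fun j => (H j : ℝ) := by
        ext j; simp
      rw [h4, dotProduct_neg] at h3
      linarith
  -- This point is the midpoint of v and W + G/2. On odd rows the slack 1/2 of v compensates an
  -- excess of at most 1/2.
  have hv' : IsMIPOptimal A b c ∅ (v - (1 / 2 : ℝ) • fun j => (H j : ℝ)) := by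
    refine ⟨mem_mipFeasible_empty.2 fun i => ?_, fun x hx => ?_⟩
    · rw [Matrix.mulVec_sub, Matrix.mulVec_smul, Pi.sub_apply, Pi.smul_apply, hV,
        map_mulVec_intCast_div, map_mulVec_intCast, smul_eq_mul]
      have h3 := hD A i
      have h4 := hDH i
      have h5 := hrow i
      have h6 := hvf i
      have h7 := hWf i
      simp only [abs_le, IsConformal] at h5
      have h8 : (A *ᵥ V) i - (A *ᵥ H) i ≤ 2 * b i := by omega
      have h9 : ((A *ᵥ V) i : ℝ) - (A *ᵥ H) i ≤ 2 * b i := by exact_mod_cast h8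
      linarith
    · rw [dotProduct_sub, dotProduct_smul, hcH, smul_zero, sub_zero]
      exact hv.2 x hx
  -- Because unit rows belong to M, each H j lies between 0 and D j, so moving by −H/2 shortens the
  -- ℓ¹ distance by exactly half the ℓ¹ norm of H.
  have habs : ∀ j, |D j - H j| + |H j| = |D j| := fun j => by
    have h3 := hH j
    have h4 := hcol j
    simp only [abs_le, IsConformal] at h4
    rcases abs_cases (D j - H j) with h5 | h5 <;> rcases abs_cases (H j) with h6 | h6 <;>
      rcases abs_cases (D j) with h7 | h7 <;> omega
  have hhalf : ∀ a : ℝ, |a| / 2 = |a / 2| := fun a => by rw [abs_div, abs_two]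
  have hH0 : ∀ j, H j = 0 := by
    have h3 := hvmin _ hv'
    have h4 : ∑ j, |v j - W j| = (∑ j, |(D j : ℝ)|) / 2 := by
      rw [Finset.sum_div]
      refine Finset.sum_congr rfl fun j _ => ?_
      rw [hhalf, hV]
      congr 1
      simp [D]
      ring
    have h5 : ∑ j, |(v - (1 / 2 : ℝ) • fun j => (H j : ℝ)) j - W j| =
        (∑ j, |(D j : ℝ)| - ∑ j, |(H j : ℝ)|) / 2 := by
      rw [← Finset.sum_sub_distrib, Finset.sum_div]
      refine Finset.sum_congr rfl fun j _ => ?_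
      have h6 : |(D j : ℝ)| - |(H j : ℝ)| = |(D j : ℝ) - H j| := by
        rw [sub_eq_iff_eq_add]
        exact_mod_cast (habs j).symm
      rw [h6, hhalf, hV]
      congr 1
      simp [D]
      ring
    rw [h4, h5] at h3
    have h6 : ∑ j, |(H j : ℝ)| = 0 :=
      le_antisymm (by linarith) (Finset.sum_nonneg fun _ _ => abs_nonneg _)
    intro j
    have h7 := (Finset.sum_eq_zero_iff_of_nonneg fun _ _ => abs_nonneg _).1 h6 j
      (Finset.mem_univ j)
    exact_mod_cast abs_eq_zero.1 h7
  refine ⟨v, hv, norm_le_of_forall_abs_le (by positivity) fun j => le_trans ?_ h1'⟩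
  have h3 := hH j
  rw [hH0 j] at h3
  have h4 := (hcol j).1
  have h5 : |V j - 2 * W j| ≤ 2 := by
    have h6 : V j - 2 * W j = G j := by
      simp only [D, Pi.sub_apply, Pi.smul_apply, smul_eq_mul] at h3
      omega
    rwa [h6]
  have h6 : |(V j : ℝ) - 2 * W j| ≤ 2 := by exact_mod_cast h5
  simp only [Pi.sub_apply, hV]
  rw [abs_le] at *
  constructor <;> linarith

end Proximity

theorem proposition6 {m n : ℕ} (A : Matrix (Fin m) (Fin n) ℤ) (b : Fin m → ℤ) (c : Fin n → ℝ)
    (hΔ_pos : 1 ≤ maxSubdet A) (hΔ : maxSubdet A ≤ 2)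
    (I J : Set (Fin n)) (hI : I = ∅ ∨ I = Set.univ) (hJ : J = ∅ ∨ J = Set.univ)
    (hJopt : ∃ z, IsMIPOptimal A b c J z)
    (w : Fin n → ℝ) (hw : IsMIPOptimal A b c I w) :
    ∃ z : Fin n → ℝ, IsMIPOptimal A b c J z ∧ ‖w - z‖ ≤ (maxSubdet A : ℝ) := by
  rcases hI with rfl | rfl <;> rcases hJ with rfl | rfl
  · exact ⟨w, hw, by simp⟩
  · obtain ⟨y, hy⟩ := hJopt
    exact exists_integer_optimal_near hΔ_pos hΔ hy hw
  · exact exists_relaxed_optimal_near hΔ_pos hΔ hJopt hw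
  · exact ⟨w, hw, by simp⟩
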